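/- Let $(\breve N,\breve g)$ be a smooth semi-Riemannian manifold (Hausdorff, second countable, $\breve g$ of constant index) with Levi-Civita connection $\breve\nabla$. Let $\breve P$ be a smooth $(1,1)$-tensor field on $\breve N$ with $\breve P^2=\breve P+I$ and $\breve g(\breve PX,Y)=\breve g(X,\breve PY)$ (a Golden structure) that is locally Golden, i.e. $\breve\nabla_X(\breve PY)=\breve P\breve\nabla_XY$ for all vector fields $X,Y$. Let $\acute N$ be an immersed submanifold of $\breve N$ that is $r$-lightlike: the spaces $Rad\,T_x\acute N=T_x\acute N\cap T_x\acute N^{\perp}$ form a smooth distribution $Rad\,T\acute N$ of rank $r\ge 1$. Fix a screen distribution $S(T\acute N)$ (a smooth complement of $Rad\,T\acute N$ in $T\acute N$), a screen transversal bundle $S(T\acute N^{\perp})$ (a smooth complement of $Rad\,T\acute N$ in $T\acute N^{\perp}$) and a smooth rank-$r$ subbundle $ltr(T\acute N)$ of $T\breve N|_{\acute N}$ such that $$T\breve N|_{\acute N}=S(T\acute N)\perp[Rad\,T\acute N\oplus ltr(T\acute N)]\perp S(T\acute N^{\perp});$$ $ltr(T\acute N)$ is not required to be null. Put $tr(T\acute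 N)=ltr(T\acute N)\perp S(T\acute N^{\perp})$, so that $T\breve N|_{\acute N}=T\acute N\oplus tr(T\acute N)$. For $W\in\Gamma(T\acute N)$ and $V\in\Gamma(tr(T\acute N))$ let $A_VW\in\Gamma(T\acute N)$ be determined by the Weingarten formula $\breve\nabla_WV=-A_VW+\nabla^t_WV$ with $\nabla^t_WV\in\Gamma(tr(T\acute N))$. Let $Q$ be the projection of $T\acute N=Rad\,T\acute N\oplus S(T\acute N)$ onto $Rad\,T\acute N$ and put $LW=\breve PQW$. Suppose that $\acute N$ is radical transversal: $\breve P(Rad\,T\acute N)=ltr(T\acute N)$ and $\breve P(S(T\acute N))=S(T\acute N)$. Then the radical distribution $Rad\,T\acute N$ is integrable (that is, $[W,U]\in\Gamma(Rad\,T\acute N)$ for all $W,U\in\Gamma(Rad\,T\acute N)$) if and only if $$A_{LU}W=A_{LW}U\qquad\text{for all }W,U\in\Gamma(Rad\,T\acute N).$$ -/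

import Mathlib

open Bundle Manifold Set Filter
open scoped Manifold ContDiff Topology

noncomputable section

/-- A semi-Riemannian metric on a manifold modelled on `ℝⁿ`: a smooth, symmetric, nondegenerate
`(0,2)`-tensor field of constant index. -/
structure SemiRiemannianMetric (n : ℕ) (M : Type*) [TopologicalSpace M]
    [ChartedSpace (EuclideanSpace ℝ (Fin n)) M] [IsManifold (𝓡 n) ∞ M] where
  /-- The bilinear form on each tangent space. -/
  inner (p : M) : TangentSpace (𝓡 n) p →L[ℝ] TangentSpace (𝓡 n) p →L[ℝ] ℝ
  symm (p : M) (u v : TangentSpace (𝓡 n) p) : inner p u v = inner p v u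
  nondegenerate (p : M) (u : TangentSpace (𝓡 n) p) (hu : ∀ v, inner p u v = 0) : u = 0
  contMDiff : ContMDiff (𝓡 n)
    ((𝓡 n).prod 𝓘(ℝ, EuclideanSpace ℝ (Fin n) →L[ℝ] EuclideanSpace ℝ (Fin n) →L[ℝ] ℝ)) ∞
    (fun p ↦ TotalSpace.mk' (EuclideanSpace ℝ (Fin n) →L[ℝ] EuclideanSpace ℝ (Fin n) →L[ℝ] ℝ)
      p (inner p))
  /-- The index: the largest dimension of a subspace on which the form is negative definite. -/
  index : ℕ
  isGreatest_index (p : M) : IsGreatest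
    {d : ℕ | ∃ V : Submodule ℝ (TangentSpace (𝓡 n) p),
      Module.finrank ℝ V = d ∧ ∀ v ∈ V, v ≠ 0 → inner p v v < 0} index

/-- A connection on the tangent bundle is the Levi-Civita connection of `g` when it is torsion
free and metric: `X (g(Y, Z)) = g(∇_X Y, Z) + g(Y, ∇_X Z)`. (In Mathlib's convention
`cov Y p v` is `(∇_v Y)(p)`.) -/
structure IsLeviCivita {n : ℕ} {M : Type*} [TopologicalSpace M]
    [ChartedSpace (EuclideanSpace ℝ (Fin n)) M] [IsManifold (𝓡 n) ∞ M]
    (g : SemiRiemannianMetric n M)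
    (cov : CovariantDerivative (𝓡 n) (EuclideanSpace ℝ (Fin n))
      (TangentSpace (𝓡 n) : M → Type _)) : Prop where
  torsion_eq_zero : cov.torsion = 0
  metric (Y Z : Π p : M, TangentSpace (𝓡 n) p) (p : M) (v : TangentSpace (𝓡 n) p)
    (hY : MDifferentiableAt (𝓡 n) (𝓡 n).tangent
      (fun q ↦ (⟨q, Y q⟩ : TangentBundle (𝓡 n) M)) p)
    (hZ : MDifferentiableAt (𝓡 n) (𝓡 n).tangent
      (fun q ↦ (⟨q, Z q⟩ : TangentBundle (𝓡 n) M)) p) :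
    mfderiv (𝓡 n) 𝓘(ℝ, ℝ) (fun q ↦ g.inner q (Y q) (Z q)) p v =
      g.inner p (cov Y p v) (Z p) + g.inner p (Y p) (cov Z p v)

/-- A Golden structure compatible with `g`: a smooth `(1,1)`-tensor field `P` with `P² = P + I`
and `g(P u, v) = g(u, P v)`. -/
structure GoldenStructure {n : ℕ} {M : Type*} [TopologicalSpace M]
    [ChartedSpace (EuclideanSpace ℝ (Fin n)) M] [IsManifold (𝓡 n) ∞ M]
    (g : SemiRiemannianMetric n M) where
  /-- The endomorphism of each tangent space. -/
  toFun (p : M) : TangentSpace (𝓡 n) p →L[ℝ] TangentSpace (𝓡 n) p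
  contMDiff : ContMDiff (𝓡 n)
    ((𝓡 n).prod 𝓘(ℝ, EuclideanSpace ℝ (Fin n) →L[ℝ] EuclideanSpace ℝ (Fin n))) ∞
    (fun p ↦ TotalSpace.mk' (E := fun q : M ↦ TangentSpace (𝓡 n) q →L[ℝ] TangentSpace (𝓡 n) q)
      (EuclideanSpace ℝ (Fin n) →L[ℝ] EuclideanSpace ℝ (Fin n)) p (toFun p))
  sq (p : M) (v : TangentSpace (𝓡 n) p) : toFun p (toFun p v) = toFun p v + v
  compatible (p : M) (u v : TangentSpace (𝓡 n) p) :
    g.inner p (toFun p u) v = g.inner p u (toFun p v)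

/-- A Golden structure is locally Golden when it is parallel for the Levi-Civita connection:
`∇_v (P Y) = P (∇_v Y)`. -/
def GoldenStructure.IsLocallyGolden {n : ℕ} {M : Type*} [TopologicalSpace M]
    [ChartedSpace (EuclideanSpace ℝ (Fin n)) M] [IsManifold (𝓡 n) ∞ M]
    {g : SemiRiemannianMetric n M} (P : GoldenStructure g)
    (cov : CovariantDerivative (𝓡 n) (EuclideanSpace ℝ (Fin n))
      (TangentSpace (𝓡 n) : M → Type _)) : Prop :=
  ∀ (Y : Π p : M, TangentSpace (𝓡 n) p) (p : M) (v : TangentSpace (𝓡 n) p),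
    MDifferentiableAt (𝓡 n) (𝓡 n).tangent (fun q ↦ (⟨q, Y q⟩ : TangentBundle (𝓡 n) M)) p →
      cov (fun q ↦ P.toFun q (Y q)) p v = P.toFun p (cov Y p v)

section Along

variable {m n : ℕ} {N M : Type*}
  [TopologicalSpace N] [ChartedSpace (EuclideanSpace ℝ (Fin m)) N] [IsManifold (𝓡 m) ∞ N]
  [TopologicalSpace M] [ChartedSpace (EuclideanSpace ℝ (Fin n)) M] [IsManifold (𝓡 n) ∞ M]

/-- A family of subspaces `D x ⊆ T_{f x} M` is a smooth rank `r` subbundle of `f* TM`: it is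
locally spanned by `r` smooth pointwise independent vector fields along `f`. For `f = id` this
says that `D` is a smooth distribution of rank `r`. -/
def IsSmoothSubbundleAlong (f : N → M) (D : Π x : N, Submodule ℝ (TangentSpace (𝓡 n) (f x)))
    (r : ℕ) : Prop :=
  ∀ x₀ : N, ∃ U ∈ 𝓝 x₀, ∃ s : Fin r → Π x : N, TangentSpace (𝓡 n) (f x),
    (∀ i, ContMDiffOn (𝓡 m) (𝓡 n).tangent ∞
      (fun x ↦ (⟨f x, s i x⟩ : TangentBundle (𝓡 n) M)) U) ∧
    ∀ x ∈ U, LinearIndependent ℝ (fun i ↦ s i x) ∧ Submodule.span ℝ (range fun i ↦ s i x) = D x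

/-- The connection `cov` on `TM` pulled back along `f`: `covAlong cov f V x w` is the derivative
`∇_w V` of a vector field `V` along `f` in the direction `w ∈ T_x N`. In a local frame `(e_i)` of
`TM` near `f x`, with `V = ∑ Vⁱ (e_i ∘ f)`, it equals
`∑ dVⁱ(w) e_i + ∑ Vⁱ(x) ∇_{df(w)} e_i`; the frame used is the one of the preferred
trivialization at `f x`. -/
def covAlong
    (cov : CovariantDerivative (𝓡 n) (EuclideanSpace ℝ (Fin n))
      (TangentSpace (𝓡 n) : M → Type _))
    (f : N → M) (V : Π x : N, TangentSpace (𝓡 n) (f x)) (x : N) (w : TangentSpace (𝓡 m) x) :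
    TangentSpace (𝓡 n) (f x) :=
  let e := trivializationAt (EuclideanSpace ℝ (Fin n)) (TangentSpace (𝓡 n) : M → Type _) (f x)
  e.symm (f x) (mfderiv (𝓡 m) 𝓘(ℝ, EuclideanSpace ℝ (Fin n))
      (fun y ↦ (e (⟨f y, V y⟩ : TangentBundle (𝓡 n) M)).2) x w)
    + cov (FiberBundle.extend (EuclideanSpace ℝ (Fin n)) (V x)) (f x)
      (mfderiv (𝓡 m) (𝓡 n) f x w)

/-- The smooth sections `Γ(D)` of a family `D` of subspaces of the tangent spaces. -/
def smoothSections (D : Π x : N, Submodule ℝ (TangentSpace (𝓡 m) x)) :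
    Set (Π x : N, TangentSpace (𝓡 m) x) :=
  {W | ContMDiff (𝓡 m) (𝓡 m).tangent ∞ (fun x ↦ (⟨x, W x⟩ : TangentBundle (𝓡 m) N)) ∧
    ∀ x, W x ∈ D x}

/-- A distribution is integrable when `[W, U] ∈ Γ(D)` for all `W, U ∈ Γ(D)`. -/
def IsIntegrableDistribution (D : Π x : N, Submodule ℝ (TangentSpace (𝓡 m) x)) : Prop :=
  ∀ W ∈ smoothSections D, ∀ U ∈ smoothSections D, ∀ x,
    VectorField.mlieBracket (𝓡 m) W U x ∈ D x

/-- The normal spaces `T_x N^⊥ ⊆ T_{f x} M`. -/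
def normalSpace (g : SemiRiemannianMetric n M) (f : N → M) (x : N) :
    Submodule ℝ (TangentSpace (𝓡 n) (f x)) where
  carrier := {u | ∀ v : TangentSpace (𝓡 m) x, g.inner (f x) u (mfderiv (𝓡 m) (𝓡 n) f x v) = 0}
  zero_mem' := fun v ↦ by simp
  add_mem' {a b} ha hb v := by
    have h₁ := ha v
    have h₂ := hb v
    simp [h₁, h₂]
  smul_mem' c a ha v := by
    have h := ha v
    simp [h]

/-- The tangent space `T_x N`, regarded as the subspace `df(T_x N)` of `T_{f x} M`. -/
def tangentImage (f : N → M) (x : N) : Submodule ℝ (TangentSpace (𝓡 n) (f x)) :=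
  LinearMap.range (mfderiv (𝓡 m) (𝓡 n) f x).toLinearMap

/-- The radical `Rad T_x N = T_x N ∩ T_x N^⊥`, as a subspace of `T_x N`. -/
def radicalSpace (g : SemiRiemannianMetric n M) (f : N → M) (x : N) :
    Submodule ℝ (TangentSpace (𝓡 m) x) :=
  (normalSpace (m := m) g f x).comap (mfderiv (𝓡 m) (𝓡 n) f x).toLinearMap

end Along

/-- An immersed `r`-lightlike submanifold `f : N → M` together with a screen distribution `S(TN)`,
a screen transversal bundle `S(TN^⊥)` and a transversal bundle `ltr(TN)` such that
`TM|_N = S(TN) ⊥ [Rad TN ⊕ ltr(TN)] ⊥ S(TN^⊥)`. The metric is automatically nondegenerate on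
`S(TN)` and `S(TN^⊥)`, being complements of the radical in `TN` and `TN^⊥`.

The bundle `ltr(TN)` is not asked to be null, so every choice of `ltr(TN)` by a null bundle with
the decomposition above is included. (A null `ltr(TN)` could never be the image of the radical
under a compatible Golden structure.) -/
structure LightlikeSubmanifold {n : ℕ} {M : Type*} [TopologicalSpace M]
    [ChartedSpace (EuclideanSpace ℝ (Fin n)) M] [IsManifold (𝓡 n) ∞ M]
    (g : SemiRiemannianMetric n M) (m : ℕ) (N : Type*) [TopologicalSpace N]
    [ChartedSpace (EuclideanSpace ℝ (Fin m)) N] [IsManifold (𝓡 m) ∞ N] (r : ℕ) where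
  /-- The immersion. -/
  f : N → M
  isImmersion : IsImmersion (𝓡 m) (𝓡 n) ∞ f
  one_le_rank : 1 ≤ r
  radical_smooth : IsSmoothSubbundleAlong (m := m) (n := m) (id : N → N) (radicalSpace g f) r
  /-- The screen distribution `S(TN)`. -/
  screen (x : N) : Submodule ℝ (TangentSpace (𝓡 m) x)
  screen_smooth : ∃ s, IsSmoothSubbundleAlong (m := m) (n := m) (id : N → N) screen s
  isCompl_radical_screen (x : N) : IsCompl (radicalSpace g f x) (screen x)
  /-- The screen transversal bundle `S(TN^⊥)`. -/
  screenTransversal (x : N) : Submodule ℝ (TangentSpace (𝓡 n) (f x))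
  screenTransversal_smooth : ∃ s, IsSmoothSubbundleAlong (m := m) f screenTransversal s
  screenTransversal_disjoint (x : N) : Disjoint (screenTransversal x)
    ((radicalSpace g f x).map (mfderiv (𝓡 m) (𝓡 n) f x).toLinearMap)
  screenTransversal_sup (x : N) :
    screenTransversal x ⊔
      (radicalSpace g f x).map (mfderiv (𝓡 m) (𝓡 n) f x).toLinearMap = normalSpace (m := m) g f x
  /-- The transversal bundle `ltr(TN)`. -/
  ltr (x : N) : Submodule ℝ (TangentSpace (𝓡 n) (f x))
  ltr_smooth : IsSmoothSubbundleAlong (m := m) f ltr r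
  ltr_disjoint (x : N) : Disjoint (ltr x) (screenTransversal x)
  ltr_orthogonal_screen (x : N) (u : TangentSpace (𝓡 n) (f x)) (v : TangentSpace (𝓡 m) x)
    (hu : u ∈ ltr x) (hv : v ∈ screen x) : g.inner (f x) u (mfderiv (𝓡 m) (𝓡 n) f x v) = 0
  ltr_orthogonal_screenTransversal (x : N) (u v : TangentSpace (𝓡 n) (f x))
    (hu : u ∈ ltr x) (hv : v ∈ screenTransversal x) : g.inner (f x) u v = 0
  /-- `TM|_N = TN ⊕ tr(TN)` with `tr(TN) = ltr(TN) ⊥ S(TN^⊥)`. -/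
  isCompl_tangent_transversal (x : N) :
    IsCompl (tangentImage (m := m) f x) (ltr x ⊔ screenTransversal x)

namespace LightlikeSubmanifold

variable {n : ℕ} {M : Type*} [TopologicalSpace M]
  [ChartedSpace (EuclideanSpace ℝ (Fin n)) M] [IsManifold (𝓡 n) ∞ M]
  {g : SemiRiemannianMetric n M} {m : ℕ} {N : Type*} [TopologicalSpace N]
  [ChartedSpace (EuclideanSpace ℝ (Fin m)) N] [IsManifold (𝓡 m) ∞ N] {r : ℕ}

/-- The radical distribution `Rad TN`. -/
def radical (X : LightlikeSubmanifold g m N r) (x : N) : Submodule ℝ (TangentSpace (𝓡 m) x) :=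
  radicalSpace g X.f x

/-- Radical transversal lightlike submanifolds: `P (Rad TN) = ltr(TN)` and
`P (S(TN)) = S(TN)`. -/
structure IsRadicalTransversal (X : LightlikeSubmanifold g m N r) (P : GoldenStructure g) :
    Prop where
  map_radical (x : N) :
    ((X.radical x).map (mfderiv (𝓡 m) (𝓡 n) X.f x).toLinearMap).map
      (P.toFun (X.f x)).toLinearMap = X.ltr x
  map_screen (x : N) :
    ((X.screen x).map (mfderiv (𝓡 m) (𝓡 n) X.f x).toLinearMap).map
      (P.toFun (X.f x)).toLinearMap =
      (X.screen x).map (mfderiv (𝓡 m) (𝓡 n) X.f x).toLinearMap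

/-- `Q`, the projection of `TN = Rad TN ⊕ S(TN)` onto `Rad TN`. -/
def radicalProj (X : LightlikeSubmanifold g m N r) (x : N) :
    TangentSpace (𝓡 m) x →ₗ[ℝ] TangentSpace (𝓡 m) x :=
  (radicalSpace g X.f x).projection (X.screen x) (X.isCompl_radical_screen x)

/-- `L W = P Q W`, a vector field along the immersion. -/
def L (X : LightlikeSubmanifold g m N r) (P : GoldenStructure g)
    (W : Π x : N, TangentSpace (𝓡 m) x) (x : N) : TangentSpace (𝓡 n) (X.f x) :=
  P.toFun (X.f x) (mfderiv (𝓡 m) (𝓡 n) X.f x (X.radicalProj x (W x)))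

/-- The shape operator `A_V W` of a vector field `V` along the immersion with values in `tr(TN)`:
by the Weingarten formula `∇_W V = - A_V W + ∇ᵗ_W V`, it is minus the tangential component of
`∇_W V` in `TM|_N = TN ⊕ tr(TN)`, where `TN` is regarded as a subbundle of `TM|_N`. -/
def shapeOperator (X : LightlikeSubmanifold g m N r)
    (cov : CovariantDerivative (𝓡 n) (EuclideanSpace ℝ (Fin n))
      (TangentSpace (𝓡 n) : M → Type _))
    (V : Π x : N, TangentSpace (𝓡 n) (X.f x)) (W : Π x : N, TangentSpace (𝓡 m) x) (x : N) :
    TangentSpace (𝓡 n) (X.f x) :=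
  -(tangentImage (m := m) X.f x).projection (X.ltr x ⊔ X.screenTransversal x)
    (X.isCompl_tangent_transversal x) (covAlong cov X.f V x (W x))

end LightlikeSubmanifold

end

noncomputable section

/-! For radical `W`, `U` one has `L U = P (df U)`. Since `P` is parallel, `∇_W (L U) = P (∇_W df
U)`, and since the torsion vanishes, `∇_W df U - ∇_U df W = df [W, U]`. Hence `A_{LU} W - A_{LW} U`
is minus the tangential part of `P (df [W, U])`. Split a tangent vector as `v = a + b`, radical plus
screen: `P (df a)` lies in `ltr(TN)` and `P (df b)` in the screen, so the tangential part of `P (df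
v)` is `P (df b)`. It vanishes exactly when `b = 0`, because `P` and `df` are injective. The two
conditions of the theorem therefore agree for each pair of sections at each point.

The analytic work is to carry the two properties of `∇` over to fields along `f`, for which
`covAlong` is given by a frame formula. `GoldenStructure.IsLocallyGolden.covAlong_apply` does this
for parallelism by a product rule for the matrix of `P`. `covAlong_sub_covAlong` does it for
torsion, by letting `[W, U]` act on the chart of `M` composed with `f`.
`IsRadicalTransversal.projection_apply_eq_zero_iff` is the algebraic part. -/

lemma Filter.EventuallyEq.mvfderiv_eq {E : Type*} [NormedAddCommGroup E] [NormedSpace ℝ E]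
    {H : Type*} [TopologicalSpace H] {I : ModelWithCorners ℝ E H}
    {M : Type*} [TopologicalSpace M] [ChartedSpace H M]
    {F : Type*} [NormedAddCommGroup F] [NormedSpace ℝ F] {f g : M → F} {x : M}
    (h : f =ᶠ[𝓝 x] g) : mvfderiv I f x = mvfderiv I g x := by
  ext u
  have h' : mfderiv I 𝓘(ℝ, F) f x = mfderiv I 𝓘(ℝ, F) g x := h.mfderiv_eq
  exact congr($h' u)

/-! ### Connections in a local frame. -/

section LocalFormula

variable {E : Type*} [NormedAddCommGroup E] [NormedSpace ℝ E]
  {H : Type*} [TopologicalSpace H] {I : ModelWithCorners ℝ E H}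
  {M : Type*} [TopologicalSpace M] [ChartedSpace H M]
  {F : Type*} [NormedAddCommGroup F] [NormedSpace ℝ F]
  {V : M → Type*} [TopologicalSpace (TotalSpace F V)]
  [∀ x, AddCommGroup (V x)] [∀ x, Module ℝ (V x)]
  [∀ x : M, TopologicalSpace (V x)]
  [∀ x, IsTopologicalAddGroup (V x)] [∀ x, ContinuousSMul ℝ (V x)]
  [FiberBundle F V] [VectorBundle ℝ F V]

/-- The flat connection of a trivialization. -/
lemma isCovariantDerivativeOn_trivialization [ContMDiffVectorBundle 1 F V I]
    (e : Trivialization F (TotalSpace.proj : TotalSpace F V → M)) [MemTrivializationAtlas e] :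
    IsCovariantDerivativeOn (I := I) F
      (fun σ x ↦ e.symmL ℝ x ∘L mvfderiv I (fun y ↦ (e ⟨y, σ y⟩).2) x) e.baseSet where
  add {σ σ' x} hσ hσ' hx := by
    rw [e.mdifferentiableAt_section_iff I _ hx] at hσ hσ'
    have h : (fun y ↦ (e ⟨y, (σ + σ') y⟩).2) =ᶠ[𝓝 x]
        fun y ↦ (e ⟨y, σ y⟩).2 + (e ⟨y, σ' y⟩).2 := by
      filter_upwards [e.open_baseSet.mem_nhds hx] with y hy
      exact (e.linear ℝ hy).map_add _ _
    have h₂ : mvfderiv I (fun y ↦ (e ⟨y, (σ + σ') y⟩).2) x = _ :=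
      (Filter.EventuallyEq.mvfderiv_eq h).trans (mvfderiv_fun_add hσ hσ')
    rw [h₂]
    ext u
    simp
  leibniz {σ a x} hσ ha hx := by
    have hσ' := hσ
    rw [e.mdifferentiableAt_section_iff I _ hx] at hσ'
    have h : (fun y ↦ (e ⟨y, (a • σ) y⟩).2) =ᶠ[𝓝 x] fun y ↦ a y • (e ⟨y, σ y⟩).2 := by
      filter_upwards [e.open_baseSet.mem_nhds hx] with y hy
      exact (e.linear ℝ hy).map_smul _ _
    have h₂ : mvfderiv I (fun y ↦ (e ⟨y, (a • σ) y⟩).2) x = _ :=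
      (Filter.EventuallyEq.mvfderiv_eq h).trans (mvfderiv_fun_smul ha hσ')
    rw [h₂]
    ext u
    have hs : e.symmL ℝ x (e ⟨x, σ x⟩).2 = σ x := by
      rw [e.symmL_apply hx, e.symm_apply_apply_mk hx]
    simp [hs]

/-- The value of a connection in the frame of the preferred trivialization at `p`. -/
lemma CovariantDerivative.apply_eq_symmL_add [FiniteDimensional ℝ F] [ContMDiffVectorBundle 1 F V I]
    (cov : CovariantDerivative I F V) {σ : Π x, V x} {p : M}
    (hσ : MDifferentiableAt I (I.prod 𝓘(ℝ, F)) (fun q ↦ (⟨q, σ q⟩ : TotalSpace F V)) p)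
    (u : TangentSpace I p) :
    cov σ p u = (trivializationAt F V p).symmL ℝ p
        (mvfderiv I (fun q ↦ (trivializationAt F V p ⟨q, σ q⟩).2) p u)
      + cov (FiberBundle.extend F (σ p)) p u := by
  set e := trivializationAt F V p
  have hp : p ∈ e.baseSet := FiberBundle.mem_baseSet_trivializationAt' p
  have hcov : IsCovariantDerivativeOn F cov e.baseSet := cov.isCovariantDerivativeOn
  have hflat := isCovariantDerivativeOn_trivialization (I := I) e
  -- The difference from the flat connection is tensorial, so it takes the same value on `σ` and on
  -- the extension of `σ p`. The latter has constant components, so its flat derivative is zero.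
  have h₁ := hcov.difference_apply hflat hp hσ
  have h₂ := hcov.difference_apply hflat hp
    (FiberBundle.mdifferentiableAt_extend I F (σ p))
  have hconst : (fun y ↦ (e ⟨y, FiberBundle.extend F (σ p) y⟩).2) =ᶠ[𝓝 p]
      fun _ ↦ (e ⟨p, σ p⟩).2 := by
    filter_upwards [e.open_baseSet.mem_nhds hp] with y hy
    simp only [FiberBundle.extend]
    rw [e.apply_mk_symm hy]
  have h₃ : mvfderiv I (fun y ↦ (e ⟨y, FiberBundle.extend F (σ p) y⟩).2) p = 0 :=
    (Filter.EventuallyEq.mvfderiv_eq hconst).trans (mvfderiv_const _)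
  rw [FiberBundle.extend_apply_self, h₁, h₃, ContinuousLinearMap.comp_zero, sub_zero,
    sub_eq_iff_eq_add'] at h₂
  exact congr($h₂ u)

end LocalFormula

/-! ### Product rule for operator-valued functions. -/

section ProductRule

variable {E : Type*} [NormedAddCommGroup E] [NormedSpace ℝ E]
  {H : Type*} [TopologicalSpace H] {I : ModelWithCorners ℝ E H}
  {M : Type*} [TopologicalSpace M] [ChartedSpace H M]
  {F₁ F₂ : Type*} [NormedAddCommGroup F₁] [NormedSpace ℝ F₁]
  [NormedAddCommGroup F₂] [NormedSpace ℝ F₂]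

lemma mvfderiv_clm_apply {A : M → F₁ →L[ℝ] F₂} {v : M → F₁} {x : M}
    (hA : MDifferentiableAt I 𝓘(ℝ, F₁ →L[ℝ] F₂) A x) (hv : MDifferentiableAt I 𝓘(ℝ, F₁) v x)
    (w : TangentSpace I x) :
    mvfderiv I (fun y ↦ A y (v y)) x w =
      A x (mvfderiv I v x w) + mvfderiv I A x w (v x) := by
  have hb : HasFDerivAt (fun q : (F₁ →L[ℝ] F₂) × F₁ ↦ q.1 q.2) _ (A x, v x) :=
    isBoundedBilinearMap_apply.hasFDerivAt (A x, v x)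
  have hp : HasMFDerivAt I 𝓘(ℝ, (F₁ →L[ℝ] F₂) × F₁) (fun y ↦ (A y, v y)) x
      ((mvfderiv I A x).prod (mvfderiv I v x)) :=
    ⟨hA.hasMFDerivAt.1.prodMk hv.hasMFDerivAt.1, hA.hasMFDerivAt.2.prodMk hv.hasMFDerivAt.2⟩
  have h := HasMFDerivAt.comp (g := fun q : (F₁ →L[ℝ] F₂) × F₁ ↦ q.1 q.2) x hb.hasMFDerivAt hp
  have h' : mfderiv I 𝓘(ℝ, F₂) (fun y ↦ A y (v y)) x = _ := h.mfderiv
  exact congr($h' w)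

end ProductRule

/-! ### Parallel endomorphisms and fields along a map. -/

section AlongMap

variable {m n : ℕ} {N M : Type*}
  [TopologicalSpace N] [ChartedSpace (EuclideanSpace ℝ (Fin m)) N]
  [TopologicalSpace M] [ChartedSpace (EuclideanSpace ℝ (Fin n)) M] [IsManifold (𝓡 n) ∞ M]

lemma covAlong_eq_symmL_add
    (cov : CovariantDerivative (𝓡 n) (EuclideanSpace ℝ (Fin n))
      (TangentSpace (𝓡 n) : M → Type _))
    (f : N → M) (V : Π x : N, TangentSpace (𝓡 n) (f x)) (x : N) (w : TangentSpace (𝓡 m) x) :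
    covAlong cov f V x w =
      (trivializationAt (EuclideanSpace ℝ (Fin n))
          (TangentSpace (𝓡 n) : M → Type _) (f x)).symmL ℝ (f x)
        (mvfderiv (𝓡 m) (fun y ↦ (trivializationAt (EuclideanSpace ℝ (Fin n))
          (TangentSpace (𝓡 n) : M → Type _) (f x) ⟨f y, V y⟩).2) x w)
      + cov (FiberBundle.extend (EuclideanSpace ℝ (Fin n)) (V x)) (f x)
        (mfderiv (𝓡 m) (𝓡 n) f x w) := by
  rw [Trivialization.symmL_apply _ (FiberBundle.mem_baseSet_trivializationAt' (f x))]
  rfl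

/-- A parallel endomorphism commutes with the derivative of vector fields along a map. -/
lemma GoldenStructure.IsLocallyGolden.covAlong_apply {g : SemiRiemannianMetric n M}
    {P : GoldenStructure g}
    {cov : CovariantDerivative (𝓡 n) (EuclideanSpace ℝ (Fin n))
      (TangentSpace (𝓡 n) : M → Type _)} (hP : P.IsLocallyGolden cov)
    {f : N → M} {V : Π x : N, TangentSpace (𝓡 n) (f x)} {x : N}
    (hV : MDifferentiableAt (𝓡 m) (𝓡 n).tangent
      (fun y ↦ (⟨f y, V y⟩ : TangentBundle (𝓡 n) M)) x) (w : TangentSpace (𝓡 m) x) :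
    covAlong cov f (fun y ↦ P.toFun (f y) (V y)) x w = P.toFun (f x) (covAlong cov f V x w) := by
  rw [covAlong_eq_symmL_add, covAlong_eq_symmL_add]
  set e := trivializationAt (EuclideanSpace ℝ (Fin n)) (TangentSpace (𝓡 n) : M → Type _) (f x)
    with he
  have hp : f x ∈ e.baseSet := FiberBundle.mem_baseSet_trivializationAt' (f x)
  -- The matrix of `P` in the frame at `f x`; differentiating `P V` leaves a term in `dA` to be
  -- identified.
  set A : M → EuclideanSpace ℝ (Fin n) →L[ℝ] EuclideanSpace ℝ (Fin n) := fun q ↦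
    ContinuousLinearMap.inCoordinates (EuclideanSpace ℝ (Fin n)) (TangentSpace (𝓡 n) : M → Type _)
      (EuclideanSpace ℝ (Fin n)) (TangentSpace (𝓡 n) : M → Type _) (f x) q (f x) q (P.toFun q)
    with hA_def
  have hA : MDifferentiableAt (𝓡 n) 𝓘(ℝ, EuclideanSpace ℝ (Fin n) →L[ℝ] EuclideanSpace ℝ (Fin n))
      A (f x) :=
    ((mdifferentiableAt_hom_bundle _).1 ((P.contMDiff (f x)).mdifferentiableAt (by simp))).2
  have hkey : ∀ q ∈ e.baseSet, ∀ v : TangentSpace (𝓡 n) q,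
      (e ⟨q, P.toFun q v⟩).2 = A q (e ⟨q, v⟩).2 := by
    intro q hq v
    simp only [hA_def]
    rw [ContinuousLinearMap.inCoordinates_eq hq hq]
    have h := (e.continuousLinearEquivAt ℝ q hq).symm_apply_apply v
    exact congr((e ⟨q, P.toFun q $h⟩).2).symm
  obtain ⟨hf, hv⟩ := (mdifferentiableAt_totalSpace _ _).1 hV
  have hAf : MDifferentiableAt (𝓡 m)
      𝓘(ℝ, EuclideanSpace ℝ (Fin n) →L[ℝ] EuclideanSpace ℝ (Fin n)) (fun y ↦ A (f y)) x :=
    hA.comp x hf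
  have hnear : ∀ᶠ q in 𝓝 (f x), q ∈ e.baseSet := e.open_baseSet.mem_nhds hp
  have h₁ : mvfderiv (𝓡 m) (fun y ↦ (e ⟨f y, P.toFun (f y) (V y)⟩).2) x w =
      A (f x) (mvfderiv (𝓡 m) (fun y ↦ (e ⟨f y, V y⟩).2) x w) +
        mvfderiv (𝓡 n) A (f x) (mfderiv (𝓡 m) (𝓡 n) f x w) (e ⟨f x, V x⟩).2 := by
    have h : (fun y ↦ (e ⟨f y, P.toFun (f y) (V y)⟩).2) =ᶠ[𝓝 x]
        fun y ↦ A (f y) (e ⟨f y, V y⟩).2 := by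
      filter_upwards [hf.continuousAt.eventually hnear] with y hy
      exact hkey _ hy _
    rw [Filter.EventuallyEq.mvfderiv_eq h, mvfderiv_clm_apply hAf hv]
    have h' : mfderiv (𝓡 m) _ (fun y ↦ A (f y)) x = _ := mfderiv_comp x hA hf
    have h'' : mvfderiv (𝓡 m) (fun y ↦ A (f y)) x w =
        mvfderiv (𝓡 n) A (f x) (mfderiv (𝓡 m) (𝓡 n) f x w) := congr($h' w)
    rw [h'']
  set Y := FiberBundle.extend (EuclideanSpace ℝ (Fin n)) (V x) with hY_def
  have hYx : Y (f x) = V x := FiberBundle.extend_apply_self _ _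
  have hY := FiberBundle.mdifferentiableAt_extend (𝓡 n) (EuclideanSpace ℝ (Fin n)) (V x)
  have hYc := (e.mdifferentiableAt_section_iff (𝓡 n) Y hp).1 hY
  have hPYc : (fun q ↦ (e ⟨q, P.toFun q (Y q)⟩).2) =ᶠ[𝓝 (f x)] fun q ↦ A q (e ⟨q, Y q⟩).2 := by
    filter_upwards [hnear] with q hq
    exact hkey _ hq _
  have hPY := (e.mdifferentiableAt_section_iff (𝓡 n) (fun q ↦ P.toFun q (Y q)) hp).2
    ((hA.clm_apply hYc).congr_of_eventuallyEq hPYc)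
  have hconst : (fun q ↦ (e ⟨q, Y q⟩).2) =ᶠ[𝓝 (f x)] fun _ ↦ (e ⟨f x, V x⟩).2 := by
    filter_upwards [hnear] with q hq
    simp only [hY_def, FiberBundle.extend, ← he]
    rw [e.apply_mk_symm hq]
  set u := mfderiv (𝓡 m) (𝓡 n) f x w
  -- Parallelism is tested on the extension `Y` of `V x`. Its components are constant, so the
  -- identity expresses exactly the `dA` term through connection terms.
  have h₂ := hP Y (f x) u hY
  rw [cov.apply_eq_symmL_add hPY u, Filter.EventuallyEq.mvfderiv_eq hPYc,
    mvfderiv_clm_apply hA hYc, Filter.EventuallyEq.mvfderiv_eq hconst, mvfderiv_const] at h₂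
  have h₃ : ∀ a, e.symmL ℝ (f x) (A (f x) a) = P.toFun (f x) (e.symmL ℝ (f x) a) := by
    intro a
    have h := hkey (f x) hp (e.symmL ℝ (f x) a)
    rw [e.symmL_apply hp a, e.apply_mk_symm hp] at h
    rw [← h, e.symmL_apply hp, e.symm_apply_apply_mk hp, e.symmL_apply hp]
  rw [h₁, map_add, map_add, h₃, ← h₂, hYx]
  simp only [zero_apply, map_zero, zero_add]
  rw [add_assoc]

end AlongMap

/-! ### Lie brackets as commutators of derivations. -/

section LieBracketAction

variable {E : Type*} [NormedAddCommGroup E] [NormedSpace ℝ E] [CompleteSpace E]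
  {H : Type*} [TopologicalSpace H] {I : ModelWithCorners ℝ E H} [I.Boundaryless]
  {M : Type*} [TopologicalSpace M] [ChartedSpace H M] [IsManifold I 2 M]
  {F : Type*} [NormedAddCommGroup F] [NormedSpace ℝ F]

/-- A vector field read in the preferred extended chart at `x`. -/
def chartVectorField (I : ModelWithCorners ℝ E H) (x : M) (U : Π y : M, TangentSpace I y) :
    E → E :=
  VectorField.mpullbackWithin 𝓘(ℝ, E) I (extChartAt I x).symm U (range I)

omit [CompleteSpace E] [I.Boundaryless] in
lemma eventually_mfderiv_extChartAt_apply (x : M) (U : Π y : M, TangentSpace I y) :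
    ∀ᶠ y in 𝓝 x, mfderiv I 𝓘(ℝ, E) (extChartAt I x) y (U y) =
      chartVectorField I x U (extChartAt I x y) := by
  have : IsManifold I 1 M := .of_le (n := 2) one_le_two
  have h := VectorField.eventuallyEq_mpullback_mpullbackWithin_extChartAt (I := I) (x := x)
    (s := univ) U
  rw [nhdsWithin_univ] at h
  filter_upwards [h, extChartAt_source_mem_nhds (I := I) x] with y hy hys
  obtain ⟨A, hA⟩ := isInvertible_mfderiv_extChartAt hys
  rw [VectorField.mpullback_apply, ← hA, ContinuousLinearMap.inverse_equiv] at hy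
  rw [← hA, hy]
  exact A.apply_symm_apply _

lemma differentiableAt_chartVectorField {x : M} {U : Π y : M, TangentSpace I y}
    (hU : MDifferentiableAt I I.tangent (fun y ↦ (⟨y, U y⟩ : TangentBundle I M)) x) :
    DifferentiableAt ℝ (chartVectorField I x U) (extChartAt I x x) := by
  have h := hU.mdifferentiableWithinAt (s := univ)
    |>.differentiableWithinAt_mpullbackWithin_vectorField
  rw [preimage_univ, univ_inter, I.range_eq_univ] at h
  have h' := h.differentiableAt univ_mem
  rw [← I.range_eq_univ] at h'
  exact h'

omit [CompleteSpace E] in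
-- The manifold bracket at `x` is the pullback of the bracket computed in the preferred chart at
-- `x`, and the differential of that chart undoes the pullback.
lemma mfderiv_extChartAt_mlieBracket (x : M) (W U : Π y : M, TangentSpace I y) :
    mfderiv I 𝓘(ℝ, E) (extChartAt I x) x (VectorField.mlieBracket I W U x) =
      VectorField.lieBracket ℝ (chartVectorField I x W) (chartVectorField I x U)
        (extChartAt I x x) := by
  have : IsManifold I 1 M := .of_le (n := 2) one_le_two
  obtain ⟨A, hA⟩ := isInvertible_mfderiv_extChartAt (mem_extChartAt_source (I := I) x)
  rw [← VectorField.mlieBracketWithin_univ, VectorField.mlieBracketWithin_apply, ← hA,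
    ContinuousLinearMap.inverse_equiv, preimage_univ, univ_inter]
  refine (A.apply_symm_apply _).trans ?_
  rw [← VectorField.lieBracketWithin_univ, ← I.range_eq_univ]
  rfl

omit [CompleteSpace E] [I.Boundaryless] in
lemma mvfderiv_comp_extChartAt {G : E → F} {x y : M} (hy : y ∈ (extChartAt I x).source)
    (hG : DifferentiableAt ℝ G (extChartAt I x y)) (u : TangentSpace I y) :
    mvfderiv I (G ∘ extChartAt I x) y u =
      fderiv ℝ G (extChartAt I x y) (mfderiv I 𝓘(ℝ, E) (extChartAt I x) y u) := by
  have : IsManifold I 1 M := .of_le (n := 2) one_le_two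
  have h : mfderiv I 𝓘(ℝ, F) (G ∘ extChartAt I x) y = _ :=
    mfderiv_comp y hG.mdifferentiableAt (mdifferentiableAt_extChartAt
      (by rwa [extChartAt_source] at hy))
  rw [mfderiv_eq_fderiv] at h
  exact congr($h u)

omit [CompleteSpace E] [IsManifold I 2 M] in
lemma contDiffAt_comp_extChartAt_symm {h : M → F} {x : M} {k : WithTop ℕ∞}
    (hh : ContMDiffAt I 𝓘(ℝ, F) k h x) :
    ContDiffAt ℝ k (h ∘ (extChartAt I x).symm) (extChartAt I x x) := by
  have h' := (contMDiffAt_iff.1 hh).2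
  rw [I.range_eq_univ] at h'
  exact contDiffWithinAt_univ.1 h'

omit [CompleteSpace E] in
-- The chart expression is needed on a neighbourhood, not only at `x`, because it is differentiated
-- once more.
lemma eventually_mvfderiv_apply {h : M → F} {x : M} (hh : ContMDiffAt I 𝓘(ℝ, F) 2 h x)
    (U : Π y : M, TangentSpace I y) :
    (fun y ↦ mvfderiv I h y (U y)) =ᶠ[𝓝 x]
      (fun z ↦ fderiv ℝ (h ∘ (extChartAt I x).symm) z (chartVectorField I x U z)) ∘
        extChartAt I x := by
  have hK : ∀ᶠ z in 𝓝 (extChartAt I x x), ContDiffAt ℝ 2 (h ∘ (extChartAt I x).symm) z :=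
    (contDiffAt_comp_extChartAt_symm hh).eventually (by simp)
  filter_upwards [eventually_mfderiv_extChartAt_apply x U, extChartAt_source_mem_nhds (I := I) x,
    (continuousAt_extChartAt x).eventually hK] with y hy hys hKy
  have hloc : h =ᶠ[𝓝 y] (h ∘ (extChartAt I x).symm) ∘ extChartAt I x := by
    filter_upwards [(isOpen_extChartAt_source (I := I) x).mem_nhds hys] with q hq
    simp only [Function.comp_apply, (extChartAt I x).left_inv hq]
  rw [Filter.EventuallyEq.mvfderiv_eq hloc, mvfderiv_comp_extChartAt hys
    (hKy.differentiableAt (by simp)), hy]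
  rfl

/-- The Lie bracket acts on functions as the commutator of the derivations. -/
lemma mvfderiv_mlieBracket {h : M → F} {x : M} (hh : ContMDiffAt I 𝓘(ℝ, F) 2 h x)
    {W U : Π y : M, TangentSpace I y}
    (hW : MDifferentiableAt I I.tangent (fun y ↦ (⟨y, W y⟩ : TangentBundle I M)) x)
    (hU : MDifferentiableAt I I.tangent (fun y ↦ (⟨y, U y⟩ : TangentBundle I M)) x) :
    mvfderiv I h x (VectorField.mlieBracket I W U x) =
      mvfderiv I (fun y ↦ mvfderiv I h y (U y)) x (W x) -
        mvfderiv I (fun y ↦ mvfderiv I h y (W y)) x (U x) := by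
  have hx := mem_extChartAt_source (I := I) x
  have hK := contDiffAt_comp_extChartAt_symm hh
  have hK' : DifferentiableAt ℝ (fderiv ℝ (h ∘ (extChartAt I x).symm)) (extChartAt I x x) :=
    (hK.fderiv_right (m := 1) (by norm_num)).differentiableAt (by simp)
  have hsymm := hK.isSymmSndFDerivAt (by simp)
  have hW' := differentiableAt_chartVectorField hW
  have hU' := differentiableAt_chartVectorField hU
  have hWx := (eventually_mfderiv_extChartAt_apply x W).self_of_nhds
  have hUx := (eventually_mfderiv_extChartAt_apply x U).self_of_nhds
  have hloc : h =ᶠ[𝓝 x] (h ∘ (extChartAt I x).symm) ∘ extChartAt I x := by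
    filter_upwards [extChartAt_source_mem_nhds (I := I) x] with q hq
    simp only [Function.comp_apply, (extChartAt I x).left_inv hq]
  rw [Filter.EventuallyEq.mvfderiv_eq (eventually_mvfderiv_apply hh U),
    Filter.EventuallyEq.mvfderiv_eq (eventually_mvfderiv_apply hh W),
    mvfderiv_comp_extChartAt hx (hK'.clm_apply hU'),
    mvfderiv_comp_extChartAt hx (hK'.clm_apply hW'),
    fderiv_clm_apply hK' hU', fderiv_clm_apply hK' hW', hWx, hUx,
    Filter.EventuallyEq.mvfderiv_eq hloc,
    mvfderiv_comp_extChartAt hx (hK.differentiableAt (by simp)),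
    mfderiv_extChartAt_mlieBracket, VectorField.lieBracket_eq]
  simp only [map_sub, add_apply, ContinuousLinearMap.comp_apply, ContinuousLinearMap.flip_apply]
  -- Symmetry of the second derivative cancels the second-order terms; what is left is the
  -- derivative along the bracket.
  rw [hsymm.eq (chartVectorField I x W (extChartAt I x x))]
  abel

end LieBracketAction

/-! ### Torsion-freeness along a map. -/

section TorsionAlong

variable {m n : ℕ} {N M : Type*}
  [TopologicalSpace N] [ChartedSpace (EuclideanSpace ℝ (Fin m)) N] [IsManifold (𝓡 m) ∞ N]
  [TopologicalSpace M] [ChartedSpace (EuclideanSpace ℝ (Fin n)) M] [IsManifold (𝓡 n) ∞ M]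

omit [IsManifold (𝓡 n) ∞ M] in
-- This makes frame components derivatives of the chart map, to which the commutator formula
-- applies.
lemma trivializationAt_tangent_apply_snd [IsManifold (𝓡 n) 1 M] {p q : M}
    (hq : q ∈ (chartAt (EuclideanSpace ℝ (Fin n)) p).source) (v : TangentSpace (𝓡 n) q) :
    (trivializationAt (EuclideanSpace ℝ (Fin n)) (TangentSpace (𝓡 n) : M → Type _) p ⟨q, v⟩).2 =
      mvfderiv (𝓡 n) (extChartAt (𝓡 n) p) q v := by
  have h := TangentBundle.continuousLinearMapAt_trivializationAt (I := 𝓡 n) hq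
  have h' : (trivializationAt (EuclideanSpace ℝ (Fin n)) (TangentSpace (𝓡 n) : M → Type _)
      p).continuousLinearMapAt ℝ q v = (trivializationAt (EuclideanSpace ℝ (Fin n))
        (TangentSpace (𝓡 n) : M → Type _) p ⟨q, v⟩).2 :=
    Trivialization.continuousLinearMapAt_apply_of_mem ℝ _ hq v
  rw [← h', h]
  rfl

omit [IsManifold (𝓡 n) ∞ M] in
lemma trivializationAt_tangent_symmL_mvfderiv [IsManifold (𝓡 n) 1 M] (p : M)
    (v : TangentSpace (𝓡 n) p) :
    (trivializationAt (EuclideanSpace ℝ (Fin n)) (TangentSpace (𝓡 n) : M → Type _) p).symmL ℝ p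
      (mvfderiv (𝓡 n) (extChartAt (𝓡 n) p) p v) = v := by
  rw [← trivializationAt_tangent_apply_snd (mem_chart_source _ p),
    Trivialization.symmL_apply _ (FiberBundle.mem_baseSet_trivializationAt' p),
    Trivialization.symm_apply_apply_mk _ (FiberBundle.mem_baseSet_trivializationAt' p)]

/-- Extensions have constant coefficients in the coordinate frame. The commutator formula for the
chart itself, viewed as a vector-valued function, then gives zero, and the differential of the chart
is injective. -/
lemma mlieBracket_extend (p : M) (u v : TangentSpace (𝓡 n) p) :
    VectorField.mlieBracket (𝓡 n) (FiberBundle.extend (EuclideanSpace ℝ (Fin n)) u)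
      (FiberBundle.extend (EuclideanSpace ℝ (Fin n)) v) p = 0 := by
  have hconst : ∀ u : TangentSpace (𝓡 n) p,
      (fun q ↦ mvfderiv (𝓡 n) (extChartAt (𝓡 n) p) q
        (FiberBundle.extend (EuclideanSpace ℝ (Fin n)) u q)) =ᶠ[𝓝 p]
      fun _ ↦ mvfderiv (𝓡 n) (extChartAt (𝓡 n) p) p u := by
    intro u
    filter_upwards [chart_source_mem_nhds (EuclideanSpace ℝ (Fin n)) p] with q hq
    rw [← trivializationAt_tangent_apply_snd hq,
      ← trivializationAt_tangent_apply_snd (mem_chart_source _ p)]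
    simp only [FiberBundle.extend]
    rw [Trivialization.apply_mk_symm _ hq]
  have h := mvfderiv_mlieBracket (I := 𝓡 n) (h := extChartAt (𝓡 n) p) (x := p)
    contMDiffAt_extChartAt
    (FiberBundle.mdifferentiableAt_extend (𝓡 n) (EuclideanSpace ℝ (Fin n)) u)
    (FiberBundle.mdifferentiableAt_extend (𝓡 n) (EuclideanSpace ℝ (Fin n)) v)
  rw [Filter.EventuallyEq.mvfderiv_eq (hconst u), Filter.EventuallyEq.mvfderiv_eq (hconst v),
    mvfderiv_const, mvfderiv_const, zero_apply, zero_apply, sub_zero] at h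
  rw [← trivializationAt_tangent_symmL_mvfderiv p (VectorField.mlieBracket _ _ _ p), h, map_zero]

omit [IsManifold (𝓡 m) ∞ N] [IsManifold (𝓡 n) ∞ M] in
lemma contMDiff_mfderiv_apply [IsManifold (𝓡 m) 1 N] [IsManifold (𝓡 n) 1 M] {f : N → M}
    (hf : ContMDiff (𝓡 m) (𝓡 n) ∞ f)
    {U : Π y : N, TangentSpace (𝓡 m) y}
    (hU : ContMDiff (𝓡 m) (𝓡 m).tangent ∞ (fun y ↦ (⟨y, U y⟩ : TangentBundle (𝓡 m) N))) :
    ContMDiff (𝓡 m) (𝓡 n).tangent ∞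
      (fun y ↦ (⟨f y, mfderiv (𝓡 m) (𝓡 n) f y (U y)⟩ : TangentBundle (𝓡 n) M)) :=
  (hf.contMDiff_tangentMap (m := ∞) (by simp)).comp hU

/-- The torsion-free property of a connection for vector fields tangent to a smooth map. -/
lemma covAlong_sub_covAlong
    {cov : CovariantDerivative (𝓡 n) (EuclideanSpace ℝ (Fin n))
      (TangentSpace (𝓡 n) : M → Type _)} (hcov : cov.torsion = 0)
    {f : N → M} (hf : ContMDiff (𝓡 m) (𝓡 n) ∞ f) {W U : Π y : N, TangentSpace (𝓡 m) y} {x : N}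
    (hW : MDifferentiableAt (𝓡 m) (𝓡 m).tangent (fun y ↦ (⟨y, W y⟩ : TangentBundle (𝓡 m) N)) x)
    (hU : MDifferentiableAt (𝓡 m) (𝓡 m).tangent (fun y ↦ (⟨y, U y⟩ : TangentBundle (𝓡 m) N)) x) :
    covAlong cov f (fun y ↦ mfderiv (𝓡 m) (𝓡 n) f y (U y)) x (W x) -
      covAlong cov f (fun y ↦ mfderiv (𝓡 m) (𝓡 n) f y (W y)) x (U x) =
    mfderiv (𝓡 m) (𝓡 n) f x (VectorField.mlieBracket (𝓡 m) W U x) := by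
  have hh : ContMDiffAt (𝓡 m) 𝓘(ℝ, EuclideanSpace ℝ (Fin n)) 2 (extChartAt (𝓡 n) (f x) ∘ f) x :=
    (contMDiffAt_extChartAt (n := 2)).comp x ((hf x).of_le ENat.LEInfty.out)
  have hd : ∀ y, f y ∈ (chartAt (EuclideanSpace ℝ (Fin n)) (f x)).source →
      ∀ v, mvfderiv (𝓡 m) (extChartAt (𝓡 n) (f x) ∘ f) y v =
        mvfderiv (𝓡 n) (extChartAt (𝓡 n) (f x)) (f y) (mfderiv (𝓡 m) (𝓡 n) f y v) := by
    intro y hy v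
    have h : mfderiv (𝓡 m) 𝓘(ℝ, EuclideanSpace ℝ (Fin n)) (extChartAt (𝓡 n) (f x) ∘ f) y = _ :=
      mfderiv_comp y (mdifferentiableAt_extChartAt hy) ((hf y).mdifferentiableAt (by simp))
    exact congr($h v)
  have hloc : ∀ V : Π y : N, TangentSpace (𝓡 m) y,
      (fun y ↦ (trivializationAt (EuclideanSpace ℝ (Fin n)) (TangentSpace (𝓡 n) : M → Type _) (f x)
        ⟨f y, mfderiv (𝓡 m) (𝓡 n) f y (V y)⟩).2) =ᶠ[𝓝 x]
      fun y ↦ mvfderiv (𝓡 m) (extChartAt (𝓡 n) (f x) ∘ f) y (V y) := by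
    intro V
    filter_upwards [hf.continuous.continuousAt.eventually
      (chart_source_mem_nhds (EuclideanSpace ℝ (Fin n)) (f x))] with y hy
    rw [trivializationAt_tangent_apply_snd hy, hd y hy]
  -- The extensions of `df W` and `df U` commute at `f x`, so the connection terms of the two
  -- `covAlong` expressions cancel.
  have htor := (cov.torsion_eq_zero_iff.1 hcov)
    (FiberBundle.mdifferentiableAt_extend (𝓡 n) (EuclideanSpace ℝ (Fin n))
      (mfderiv (𝓡 m) (𝓡 n) f x (W x)))
    (FiberBundle.mdifferentiableAt_extend (𝓡 n) (EuclideanSpace ℝ (Fin n))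
      (mfderiv (𝓡 m) (𝓡 n) f x (U x)))
  rw [mlieBracket_extend, FiberBundle.extend_apply_self, FiberBundle.extend_apply_self] at htor
  rw [covAlong_eq_symmL_add, covAlong_eq_symmL_add, Filter.EventuallyEq.mvfderiv_eq (hloc U),
    Filter.EventuallyEq.mvfderiv_eq (hloc W), add_sub_add_comm, htor, add_zero, ← map_sub,
    ← mvfderiv_mlieBracket hh hW hU, hd x (mem_chart_source _ _),
    trivializationAt_tangent_symmL_mvfderiv]

end TorsionAlong

/-! ### Immersions have injective differential. -/

section Immersion

variable {m n : ℕ} {N M : Type*}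
  [TopologicalSpace N] [ChartedSpace (EuclideanSpace ℝ (Fin m)) N]
  [TopologicalSpace M] [ChartedSpace (EuclideanSpace ℝ (Fin n)) M]

/-- In adapted charts `f` is `u ↦ (u, 0)` up to a linear equivalence. Projecting to the first factor
gives a local left inverse, and the chain rule applies. -/
lemma Manifold.IsImmersionAt.mfderiv_injective {f : N → M} {x : N}
    (hf : IsImmersionAt (𝓡 m) (𝓡 n) ∞ f x) :
    Function.Injective (mfderiv (𝓡 m) (𝓡 n) f x) := by
  set D := hf.domChart.extend (𝓡 m)
  set C := hf.codChart.extend (𝓡 n)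
  set G : EuclideanSpace ℝ (Fin n) →L[ℝ] EuclideanSpace ℝ (Fin m) :=
    ContinuousLinearMap.fst ℝ _ _ ∘L
      (hf.equiv.symm : EuclideanSpace ℝ (Fin n) →L[ℝ] EuclideanSpace ℝ (Fin m) × hf.complement)
  have hxs := hf.mem_domChart_source
  have hval : ∀ y ∈ hf.domChart.source, G (C (f y)) = D y := by
    intro y hy
    have hyD : y ∈ D.source := by rwa [OpenPartialHomeomorph.extend_source]
    have h : C (f (D.symm (D y))) = hf.equiv (D y, 0) := hf.writtenInCharts (D.map_source hyD)
    rw [D.left_inv hyD] at h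
    have h' : G (C (f y)) = (hf.equiv.symm (C (f y))).1 := rfl
    rw [h', h, ContinuousLinearEquiv.symm_apply_apply]
  have hloc : D.symm ∘ (G ∘ C) ∘ f =ᶠ[𝓝 x] id := by
    filter_upwards [hf.domChart.open_source.mem_nhds hxs] with y hy
    simp only [Function.comp_apply, hval y hy, id]
    exact hf.domChart.extend_left_inv hy
  have hC : MDifferentiableAt (𝓡 n) 𝓘(ℝ, EuclideanSpace ℝ (Fin n)) C (f x) :=
    (OpenPartialHomeomorph.contMDiffAt_extend hf.codChart_mem_maximalAtlas
      hf.mem_codChart_source).mdifferentiableAt (by simp)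
  have hG : MDifferentiableAt 𝓘(ℝ, EuclideanSpace ℝ (Fin n)) 𝓘(ℝ, EuclideanSpace ℝ (Fin m)) G
      (C (f x)) := G.differentiableAt.mdifferentiableAt
  have hD : MDifferentiableAt 𝓘(ℝ, EuclideanSpace ℝ (Fin m)) (𝓡 m) D.symm (G (C (f x))) := by
    rw [hval x hxs]
    have h := contMDiffOn_extend_symm hf.domChart_mem_maximalAtlas
    refine ((h _ ⟨hf.domChart x, hf.domChart.map_source hxs, rfl⟩).contMDiffAt ?_).mdifferentiableAt
      (by simp)
    -- The model has no boundary, so the extended chart has open target and smoothness there is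
    -- smoothness at the point.
    exact ((𝓡 m).toHomeomorph.isOpenMap _ hf.domChart.open_target).mem_nhds
      ⟨hf.domChart x, hf.domChart.map_source hxs, rfl⟩
  have hfx : MDifferentiableAt (𝓡 m) (𝓡 n) f x := hf.contMDiffAt.mdifferentiableAt (by simp)
  have hcomp := mfderiv_comp x (hD.comp (f x) (hG.comp (f x) hC)) hfx
  have hid : mfderiv (𝓡 m) (𝓡 m) ((D.symm ∘ (G ∘ C)) ∘ f) x = ContinuousLinearMap.id ℝ _ :=
    hloc.mfderiv_eq.trans mfderiv_id
  intro u v huv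
  have := congr($hcomp u)
  have h2 := congr($hcomp v)
  rw [hid] at this h2
  simp only [ContinuousLinearMap.comp_apply, huv] at this h2
  exact this.trans h2.symm

end Immersion

/-! ### Injectivity of a Golden structure. -/

namespace GoldenStructure

variable {n : ℕ} {M : Type*} [TopologicalSpace M]
  [ChartedSpace (EuclideanSpace ℝ (Fin n)) M] [IsManifold (𝓡 n) ∞ M] {g : SemiRiemannianMetric n M}

lemma injective (P : GoldenStructure g) (p : M) : Function.Injective (P.toFun p) := by
  rw [injective_iff_map_eq_zero]
  intro v hv
  have h := P.sq p v
  rwa [hv, map_zero, zero_add, eq_comm] at h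

end GoldenStructure

/-! ### Radical transversality and shape operators. -/

namespace LightlikeSubmanifold

variable {n : ℕ} {M : Type*} [TopologicalSpace M]
  [ChartedSpace (EuclideanSpace ℝ (Fin n)) M] [IsManifold (𝓡 n) ∞ M]
  {g : SemiRiemannianMetric n M} {m : ℕ} {N : Type*} [TopologicalSpace N]
  [ChartedSpace (EuclideanSpace ℝ (Fin m)) N] [IsManifold (𝓡 m) ∞ N] {r : ℕ}

lemma contMDiff_f (X : LightlikeSubmanifold g m N r) : ContMDiff (𝓡 m) (𝓡 n) ∞ X.f :=
  X.isImmersion.contMDiff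

lemma L_eq_of_mem_radical (X : LightlikeSubmanifold g m N r) (P : GoldenStructure g)
    {W : Π x : N, TangentSpace (𝓡 m) x} (hW : ∀ x, W x ∈ X.radical x) :
    X.L P W = fun x ↦ P.toFun (X.f x) (mfderiv (𝓡 m) (𝓡 n) X.f x (W x)) := by
  funext x
  have h : X.radicalProj x (W x) = W x :=
    Submodule.projection_apply_of_mem_left (X.isCompl_radical_screen x) (hW x)
  simp only [L, h]

/-- On a radical transversal submanifold, `P v` is transversal precisely when `v` is radical. -/
lemma IsRadicalTransversal.projection_apply_eq_zero_iff {X : LightlikeSubmanifold g m N r}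
    {P : GoldenStructure g} (hX : X.IsRadicalTransversal P) (x : N) (v : TangentSpace (𝓡 m) x) :
    (tangentImage (m := m) X.f x).projection (X.ltr x ⊔ X.screenTransversal x)
      (X.isCompl_tangent_transversal x)
      (P.toFun (X.f x) (mfderiv (𝓡 m) (𝓡 n) X.f x v)) = 0 ↔ v ∈ X.radical x := by
  rw [Submodule.projection_apply_eq_zero_iff]
  have hltr : ∀ a ∈ X.radical x,
      P.toFun (X.f x) (mfderiv (𝓡 m) (𝓡 n) X.f x a) ∈ X.ltr x ⊔ X.screenTransversal x := by
    intro a ha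
    refine Submodule.mem_sup_left ?_
    rw [← hX.map_radical x]
    exact Submodule.mem_map_of_mem (Submodule.mem_map_of_mem ha)
  refine ⟨fun hv ↦ ?_, hltr v⟩
  obtain ⟨a, ha, b, hb, rfl⟩ := Submodule.mem_sup.1
    ((X.isCompl_radical_screen x).sup_eq_top ▸ Submodule.mem_top : v ∈ _)
  rw [map_add, map_add] at hv
  -- For the screen part `b`, the vector `P (df b)` is transversal by subtraction and tangent by
  -- invariance of the screen, hence zero.
  have hb₁ : P.toFun (X.f x) (mfderiv (𝓡 m) (𝓡 n) X.f x b) ∈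
      X.ltr x ⊔ X.screenTransversal x := (Submodule.add_mem_iff_right _ (hltr a ha)).1 hv
  have hb₂ : P.toFun (X.f x) (mfderiv (𝓡 m) (𝓡 n) X.f x b) ∈ tangentImage (m := m) X.f x := by
    have h : P.toFun (X.f x) (mfderiv (𝓡 m) (𝓡 n) X.f x b) ∈
        (X.screen x).map (mfderiv (𝓡 m) (𝓡 n) X.f x).toLinearMap := by
      rw [← hX.map_screen x]
      exact Submodule.mem_map_of_mem (Submodule.mem_map_of_mem hb)
    exact LinearMap.map_le_range h
  have hb₃ := Submodule.disjoint_def.1 (X.isCompl_tangent_transversal x).disjoint _ hb₂ hb₁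
  have hb₄ : b = 0 := (X.isImmersion.isImmersionAt x).mfderiv_injective
    (P.injective _ (by rw [hb₃, map_zero, map_zero]))
  rw [hb₄, add_zero]
  exact ha

/-- The difference of shape operators of `L U` and `L W` measures the bracket `[W, U]`. -/
lemma shapeOperator_L_eq_iff {X : LightlikeSubmanifold g m N r} {P : GoldenStructure g}
    {cov : CovariantDerivative (𝓡 n) (EuclideanSpace ℝ (Fin n))
      (TangentSpace (𝓡 n) : M → Type _)}
    (hcov : IsLeviCivita g cov) (hP : P.IsLocallyGolden cov) (hX : X.IsRadicalTransversal P)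
    {W U : Π x : N, TangentSpace (𝓡 m) x} (hW : W ∈ smoothSections X.radical)
    (hU : U ∈ smoothSections X.radical) (x : N) :
    X.shapeOperator cov (X.L P U) W x = X.shapeOperator cov (X.L P W) U x ↔
      VectorField.mlieBracket (𝓡 m) W U x ∈ X.radical x := by
  have hdW := (contMDiff_mfderiv_apply X.contMDiff_f hW.1 x).mdifferentiableAt (by simp)
  have hdU := (contMDiff_mfderiv_apply X.contMDiff_f hU.1 x).mdifferentiableAt (by simp)
  rw [← hX.projection_apply_eq_zero_iff x, ← covAlong_sub_covAlong hcov.torsion_eq_zero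
    X.contMDiff_f ((hW.1 x).mdifferentiableAt (by simp)) ((hU.1 x).mdifferentiableAt (by simp)),
    X.L_eq_of_mem_radical P hU.2, X.L_eq_of_mem_radical P hW.2]
  simp only [shapeOperator]
  rw [hP.covAlong_apply hdU, hP.covAlong_apply hdW, neg_inj, map_sub, map_sub, sub_eq_zero]

end LightlikeSubmanifold

end

theorem mainTheorem5 {m n r : ℕ}
    {M : Type*} [TopologicalSpace M] [T2Space M] [SecondCountableTopology M]
    [ChartedSpace (EuclideanSpace ℝ (Fin n)) M] [IsManifold (𝓡 n) ∞ M]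
    {N : Type*} [TopologicalSpace N] [T2Space N] [SecondCountableTopology N]
    [ChartedSpace (EuclideanSpace ℝ (Fin m)) N] [IsManifold (𝓡 m) ∞ N]
    (g : SemiRiemannianMetric n M) (P : GoldenStructure g)
    (cov : CovariantDerivative (𝓡 n) (EuclideanSpace ℝ (Fin n))
      (TangentSpace (𝓡 n) : M → Type _))
    (hcov : IsLeviCivita g cov) (hP : P.IsLocallyGolden cov)
    (X : LightlikeSubmanifold g m N r) (hX : X.IsRadicalTransversal P) :
    IsIntegrableDistribution X.radical ↔
      ∀ W ∈ smoothSections X.radical, ∀ U ∈ smoothSections X.radical, ∀ x : N,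
        X.shapeOperator cov (X.L P U) W x = X.shapeOperator cov (X.L P W) U x :=
  forall₄_congr fun _ hW _ hU ↦ forall_congr' fun x ↦
    (LightlikeSubmanifold.shapeOperator_L_eq_iff hcov hP hX hW hU x).symm
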